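/- Let $n\ge 0$ be an integer and let $X$ be a contractible metric space whose $(n+1)$-dimensional Hausdorff measure is zero, $\mathcal H^{n+1}(X)=0$. An embedded closed $n$-dimensional ball in $X$ is a subset $D=f(\overline{\mathbb B}^n)$, where $f:\overline{\mathbb B}^n\to X$ is a homeomorphism onto its image and $\overline{\mathbb B}^n\subset\mathbb R^n$ is the closed Euclidean unit ball; its boundary is $f(\mathbb S^{n-1})$, where $\mathbb S^{n-1}\subset\mathbb R^n$ is the unit sphere (empty if $n=0$). If $D_1,D_2\subset X$ are two embedded closed $n$-dimensional balls with the same boundary, then $D_1=D_2$. -/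

import Mathlib

/-- `D` is an embedded closed `n`-dimensional ball in `X` with boundary `S`: some topological
embedding of the closed Euclidean unit ball of `ℝⁿ` into `X` has image `D` and maps the unit
sphere (the boundary of the ball, empty for `n = 0`) onto `S`. -/
def IsEmbeddedClosedBall {X : Type*} [TopologicalSpace X] (n : ℕ) (D S : Set X) : Prop :=
  ∃ f : Metric.closedBall (0 : EuclideanSpace ℝ (Fin n)) 1 → X,
    Topology.IsEmbedding f ∧ Set.range f = D ∧
      f '' {p | (p : EuclideanSpace ℝ (Fin n)) ∈ Metric.sphere (0 : EuclideanSpace ℝ (Fin n)) 1} = S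

/-! By symmetry it suffices that `D₁ ⊆ D₂`. Suppose a point `a` of `D₁` lies off `D₂`; it is then
interior to the ball `D₁`, which can be reparametrized to have `a` as center. The two balls, glued
along their boundary, form an `n`-sphere in `X`, and contractibility fills it by a map `F` from the
`(n+1)`-ball (`exists_continuous_filling`). Let `h : X → ℝⁿ × ℝ` have as first component a
continuous left inverse of the parametrization of `D₁`, and as second the distance to `D₂` minus a
constant `r`. On the unit sphere `h ∘ F` never points opposite to the position vector, so Brouwer
theory makes it, and every small perturbation of it, vanish somewhere in the ball.

On the other hand, `h` can be approximated by a Lipschitz map, whose image is null because `ℋⁿ⁺¹(X)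
= 0`; subtracting a small missed value `q` leaves a field without zeros
(`LipschitzWith.exists_norm_lt_notMem_range`). This contradicts `exists_mem_sphere_eq_neg_smul`, and
the clash is worked out in `apply_zero_mem_image_closedBall`.

The Brouwer input is the analytic no-retraction theorem: the integral over the ball of the Jacobian
of `x + t (f x - x)` is polynomial in `t`, equals the volume for small `t > 0`, yet vanishes at `t =
1`. -/

/-! ### No-retraction theorem and nowhere vanishing vector fields -/

section BrouwerTheory

open Metric Set MeasureTheory Filter Topology
open scoped NNReal ENNReal ContDiff

/-- For an endomorphism `A` of a finite-dimensional space, `t ↦ det (1 + t A)` is polynomial of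
degree at most the dimension, so its value at `1` is a fixed linear combination of its values at
any sufficiently many distinct nodes. -/
theorem LinearMap.det_one_add_eq_sum_lagrange {E : Type*} [AddCommGroup E] [Module ℝ E]
    [FiniteDimensional ℝ E] (v : ℕ → ℝ) (hv : Function.Injective v) (A : E →ₗ[ℝ] E) :
    LinearMap.det (1 + A) = ∑ i ∈ Finset.range (Module.finrank ℝ E + 1),
      LinearMap.det (1 + v i • A) *
        (Lagrange.basis (Finset.range (Module.finrank ℝ E + 1)) v i).eval 1 := by
  set b := Module.finBasis ℝ E
  set M := LinearMap.toMatrix b b A with hM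
  set p : Polynomial ℝ := Matrix.det ((Polynomial.X : Polynomial ℝ) • M.map Polynomial.C +
    (1 : Matrix _ _ ℝ).map Polynomial.C) with hp
  have hdet (t : ℝ) : p.eval t = LinearMap.det (1 + t • A) := by
    rw [← LinearMap.det_toMatrix b, hp, ← Polynomial.coe_evalRingHom, RingHom.map_det]
    congr 1
    ext i j
    simp [hM, LinearMap.toMatrix_one, Matrix.one_apply, add_comm, Polynomial.eval_add, apply_ite]
    split_ifs <;> ring
  have hdeg : p.degree < (Finset.range (Module.finrank ℝ E + 1)).card := by
    rw [Finset.card_range]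
    refine (Polynomial.degree_le_of_natDegree_le
      (Polynomial.natDegree_det_X_add_C_le M 1)).trans_lt ?_
    simp only [Fintype.card_fin]
    exact_mod_cast Nat.lt_succ_self _
  have h := congrArg (Polynomial.eval 1) (Lagrange.eq_interpolate hv.injOn hdeg)
  rw [hdet, one_smul] at h
  rw [h, Lagrange.interpolate_apply, Polynomial.eval_finsetSum]
  exact Finset.sum_congr rfl fun i _ ↦ by simp [hdet]

/-- A function that is Lipschitz on the closed unit ball and vanishes on the unit sphere is
Lipschitz when extended by zero. -/
theorem LipschitzOnWith.indicator_closedBall {E F : Type*} [NormedAddCommGroup E]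
    [NormedSpace ℝ E] [SeminormedAddCommGroup F] {g : E → F} {L : ℝ≥0}
    (hg : LipschitzOnWith L g (closedBall 0 1)) (h0 : ∀ x, ‖x‖ = 1 → g x = 0) :
    LipschitzWith L ((closedBall (0 : E) 1).indicator g) := by
  have key : ∀ x ∈ closedBall (0 : E) 1, ∀ y ∉ closedBall (0 : E) 1,
      dist (g x) 0 ≤ L * dist x y := by
    intro x hx y hy
    simp only [mem_closedBall, dist_zero_right, not_le] at hx hy
    -- The segment from `x` to `y` crosses the unit sphere, where `g` vanishes, at a point no
    -- farther from `x` than `y` is.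
    have hc : ContinuousOn (fun t : ℝ ↦ ‖AffineMap.lineMap x y t‖) (Icc 0 1) :=
      (AffineMap.lineMap_continuous.norm).continuousOn
    obtain ⟨t, ht, hz⟩ := intermediate_value_Icc zero_le_one hc
      (show (1 : ℝ) ∈ Icc _ _ by simpa using ⟨hx, hy.le⟩)
    rw [← h0 _ hz]
    refine (hg.dist_le_mul _ (by simpa using hx) _ (by simpa using hz.le)).trans ?_
    gcongr
    rw [dist_left_lineMap, Real.norm_of_nonneg ht.1]
    exact mul_le_of_le_one_left dist_nonneg ht.2
  refine LipschitzWith.of_dist_le_mul fun x y ↦ ?_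
  by_cases hx : x ∈ closedBall (0 : E) 1 <;> by_cases hy : y ∈ closedBall (0 : E) 1
  · simpa [indicator_of_mem hx, indicator_of_mem hy] using hg.dist_le_mul x hx y hy
  · simpa only [indicator_of_mem hx, indicator_of_notMem hy] using key x hx y hy
  · simpa only [indicator_of_mem hy, indicator_of_notMem hx, dist_comm] using key y hy x hx
  · simp only [indicator_of_notMem hx, indicator_of_notMem hy, dist_self]; positivity

/-- A contracting perturbation of the identity that maps the closed unit ball to itself and is
supported in that ball maps the ball bijectively onto itself. -/
theorem bijOn_closedBall_id_add {E : Type*} [NormedAddCommGroup E] [NormedSpace ℝ E]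
    [CompleteSpace E] {g : E → E} {L : ℝ≥0} (hL : L < 1) (hg : LipschitzWith L g)
    (h0 : ∀ x ∉ closedBall (0 : E) 1, g x = 0)
    (hmaps : MapsTo (fun x ↦ x + g x) (closedBall 0 1) (closedBall 0 1)) :
    BijOn (fun x ↦ x + g x) (closedBall 0 1) (closedBall 0 1) := by
  refine ⟨hmaps, fun x _ y _ hxy ↦ ?_, fun y hy ↦ ?_⟩
  · by_contra hne
    have h1 : dist x y = dist (g y) (g x) := by
      rw [dist_eq_norm, dist_eq_norm]; congr 1
      simp only at hxy
      rw [sub_eq_sub_iff_add_eq_add, hxy, add_comm]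
    have h2 := hg.dist_le_mul y x
    rw [← h1, dist_comm y x] at h2
    have h3 : 0 < dist x y := dist_pos.2 hne
    have h4 : (L : ℝ) < 1 := hL
    nlinarith
  · have hc : ContractingWith L (fun x ↦ y - g x) :=
      ⟨hL, LipschitzWith.of_dist_le_mul fun a b ↦ by
        rw [dist_sub_left]; exact hg.dist_le_mul a b⟩
    have hfix : y - g hc.fixedPoint = hc.fixedPoint := hc.fixedPoint_isFixedPt
    have hsum : hc.fixedPoint + g hc.fixedPoint = y := by
      rw [← eq_sub_iff_add_eq, hfix]
    refine ⟨hc.fixedPoint, ?_, hsum⟩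
    -- Outside the ball `g` vanishes, so the fixed point would be `y` itself, which lies in the
    -- ball.
    by_contra hout
    rw [h0 _ hout, add_zero] at hsum
    exact hout (by rwa [hsum])

/-- There is no `C¹` retraction of the closed unit ball onto the unit sphere. -/
theorem not_exists_contDiff_retraction_sphere {E : Type*} [NormedAddCommGroup E]
    [InnerProductSpace ℝ E] [FiniteDimensional ℝ E] (f : E → E) (hf : ContDiff ℝ 1 f)
    (hnorm : ∀ x, ‖f x‖ = 1) (hid : ∀ x, ‖x‖ = 1 → f x = x) : False := by
  let _ : MeasurableSpace E := borel E
  have _ : BorelSpace E := ⟨rfl⟩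
  set μ : Measure E := Measure.addHaar
  set B : Set E := closedBall 0 1
  have hBc : IsCompact B := isCompact_closedBall 0 1
  set g : E → E := fun x ↦ f x - x with hgdef
  have hg : ContDiff ℝ 1 g := hf.sub contDiff_id
  have hgc : Continuous (fderiv ℝ g) := hg.continuous_fderiv one_ne_zero
  obtain ⟨L, hL⟩ : ∃ L, LipschitzOnWith L g B :=
    hg.locallyLipschitz.locallyLipschitzOn.exists_lipschitzOnWith_of_compact hBc
  have hLi := hL.indicator_closedBall fun x hx ↦ by simp [hgdef, hid x hx]
  -- the Jacobian determinant of `x ↦ x + t g x`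
  set J : ℝ → E → ℝ := fun t x ↦ LinearMap.det (1 + t • (fderiv ℝ g x : E →ₗ[ℝ] E)) with hJ
  have hJ' (t : ℝ) (x : E) : J t x = (ContinuousLinearMap.id ℝ E + t • fderiv ℝ g x).det := rfl
  have hJc : Continuous (fun p : ℝ × E ↦ J p.1 p.2) := by
    simp only [hJ']
    exact ContinuousLinearMap.continuous_det.comp
      (continuous_const.add (continuous_fst.smul (hgc.comp continuous_snd)))
  have hpos : ∀ᶠ t in 𝓝 (0 : ℝ), ∀ x ∈ B, 0 < J t x := by
    refine hBc.eventually_forall_of_forall_eventually fun x _ ↦ ?_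
    refine hJc.continuousAt.eventually (lt_mem_nhds ?_)
    simp [hJ]
  -- For `0 < t ≤ ε`: `ε ≤ 1` makes `x + t g x` a convex combination of `x` and `f x`, `ε < δ` keeps
  -- the Jacobian positive, and `ε L < 1` makes the perturbation contracting.
  obtain ⟨δ, hδ, hδpos⟩ := Metric.eventually_nhds_iff.1 hpos
  obtain ⟨ε, hε, hε1, hεδ, hεL⟩ : ∃ ε : ℝ, 0 < ε ∧ ε ≤ 1 ∧ ε < δ ∧ ε * L < 1 := by
    refine ⟨min (1 / (L + 1)) (δ / 2), by positivity, ?_, ?_, ?_⟩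
    · exact (min_le_left _ _).trans (div_le_one_of_le₀ (by simp) (by positivity))
    · exact (min_le_right _ _).trans_lt (by linarith)
    · calc _ ≤ 1 / ((L : ℝ) + 1) * L := by gcongr; exact min_le_left _ _
        _ < 1 := by rw [one_div, inv_mul_lt_iff₀ (by positivity)]; linarith
  have hint (t : ℝ) : IntegrableOn (J t) B μ :=
    (hJc.comp (Continuous.prodMk_right t)).continuousOn.integrableOn_compact hBc
  -- for small `t` the integral of the Jacobian is the volume of the ball
  have hvol : ∀ t, 0 < t → t ≤ ε → ∫ x in B, J t x ∂μ = μ.real B := by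
    intro t ht0 htε
    have hbij : BijOn (fun x ↦ x + t • B.indicator g x) B B := by
      refine bijOn_closedBall_id_add (L := t.toNNReal * L) (E := E) ?_ ?_ ?_ ?_
      · rw [← NNReal.coe_lt_coe]
        rw [NNReal.coe_mul, Real.coe_toNNReal t ht0.le, NNReal.coe_one]
        exact lt_of_le_of_lt (mul_le_mul_of_nonneg_right htε L.2) hεL
      · refine LipschitzWith.of_dist_le_mul fun a b ↦ ?_
        rw [dist_smul₀, Real.norm_of_nonneg ht0.le]
        rw [NNReal.coe_mul, Real.coe_toNNReal t ht0.le, mul_assoc]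
        exact mul_le_mul_of_nonneg_left (hLi.dist_le_mul a b) ht0.le
      · intro x hx
        simp only [B, indicator_of_notMem hx, smul_zero]
      · intro x hx
        have : x + t • g x = (1 - t) • x + t • f x := by simp only [hgdef]; module
        simp only [B, indicator_of_mem hx, this]
        exact convex_closedBall (0 : E) 1 hx (by simp [hnorm]) (by linarith) ht0.le (by ring)
    have hbij' : BijOn (fun x ↦ x + t • g x) B B :=
      hbij.congr fun x hx ↦ by simp only [indicator_of_mem hx]
    have hd : ∀ x ∈ B, HasFDerivWithinAt (fun x ↦ x + t • g x)
        (ContinuousLinearMap.id ℝ E + t • fderiv ℝ g x) B x := fun x _ ↦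
      ((hasFDerivAt_id x).add ((hg.differentiable one_ne_zero x).hasFDerivAt.const_smul
        t)).hasFDerivWithinAt
    have := integral_image_eq_integral_abs_det_fderiv_smul μ hBc.measurableSet hd hbij'.injOn
      (fun _ ↦ (1 : ℝ))
    rw [hbij'.image_eq] at this
    simp only [smul_eq_mul, mul_one, integral_const, measureReal_restrict_apply_univ] at this
    rw [this]
    refine setIntegral_congr_fun hBc.measurableSet fun x hx ↦ ?_
    simp only [hJ']
    rw [abs_of_pos]
    rw [← hJ']
    exact hδpos (by rw [dist_zero_right, Real.norm_of_nonneg ht0.le]; linarith) x hx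
  -- hence, by interpolation, so it is at `t = 1`
  set v : ℕ → ℝ := fun i ↦ ε / (i + 1) with hvdef
  have hv : Function.Injective v := by
    intro i j hij
    have h1 : ((i : ℝ) + 1) ≠ 0 := by positivity
    have h2 : ((j : ℝ) + 1) ≠ 0 := by positivity
    simp only [hvdef] at hij
    field_simp at hij
    have h3 : (i : ℝ) = j := by linarith
    exact_mod_cast h3
  have hone : ∫ x in B, J 1 x ∂μ = μ.real B := by
    have h1 : ∀ x, J 1 x = ∑ i ∈ Finset.range (Module.finrank ℝ E + 1), J (v i) x *
        (Lagrange.basis (Finset.range (Module.finrank ℝ E + 1)) v i).eval 1 := fun x ↦ by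
      simp only [hJ, one_smul]
      exact LinearMap.det_one_add_eq_sum_lagrange v hv _
    simp only [h1]
    rw [integral_finsetSum _ fun i _ ↦ (hint _).mul_const _]
    simp only [integral_mul_const]
    have h2 : ∀ i, ∫ x in B, J (v i) x ∂μ = μ.real B := fun i ↦
      hvol _ (by positivity) (div_le_self hε.le (by simp))
    simp only [h2]
    -- The integral is the same at all nodes, and the Lagrange basis polynomials sum to `1`.
    rw [← Finset.mul_sum, ← Polynomial.eval_finsetSum,
      Lagrange.sum_basis hv.injOn (by simp), Polynomial.eval_one, mul_one]
  -- Differentiating `‖f‖² = 1` shows that the range of the derivative at `x` is orthogonal to `f x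
  -- ≠ 0`, so the derivative is not surjective.
  have hzero : ∀ x, J 1 x = 0 := by
    intro x
    have hdf : HasFDerivAt f (ContinuousLinearMap.id ℝ E + (1 : ℝ) • fderiv ℝ g x) x := by
      have := (hasFDerivAt_id x).add (hg.differentiable one_ne_zero x).hasFDerivAt
      rw [one_smul]
      refine this.congr_of_eventuallyEq (Eventually.of_forall fun y ↦ ?_)
      simp [hgdef]
    by_contra hne
    rw [hJ'] at hne
    set A := ContinuousLinearMap.id ℝ E + (1 : ℝ) • fderiv ℝ g x
    have hsurj : Function.Surjective A :=
      (LinearMap.equivOfDetNeZero (A : E →ₗ[ℝ] E) hne).surjective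
    obtain ⟨w, hw⟩ := hsurj (f x)
    have hin := (hdf.inner ℝ hdf)
    have hconst : (fun y ↦ inner ℝ (f y) (f y)) = fun _ ↦ (1 : ℝ) := by
      ext y; rw [real_inner_self_eq_norm_sq, hnorm]; norm_num
    rw [hconst] at hin
    have := congrArg (fun T ↦ T w) (hin.unique (hasFDerivAt_const (1 : ℝ) x))
    simp [hw, hnorm] at this
  simp only [hzero, integral_zero] at hone
  exact (ENNReal.toReal_pos (measure_closedBall_pos μ (0 : E) one_pos).ne'
    hBc.measure_lt_top.ne).ne hone

/-- A nowhere vanishing continuous vector field on a Euclidean space points in the direction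
opposite to the position vector somewhere on the unit sphere. -/
theorem exists_mem_sphere_eq_neg_smul {E : Type*} [NormedAddCommGroup E]
    [InnerProductSpace ℝ E] [FiniteDimensional ℝ E] (u : E → E) (hu : Continuous u)
    (hu0 : ∀ x, u x ≠ 0) : ∃ w, ‖w‖ = 1 ∧ ∃ c : ℝ, 0 ≤ c ∧ u w = -(c • w) := by
  by_contra! hcon
  -- `V` is `u` on the unit ball and the identity beyond radius `2`. Between them it interpolates
  -- along rays, and a zero there would make `u (P x)` a nonpositive multiple of `P x`.
  set P : E → E := fun x ↦ (max 1 ‖x‖)⁻¹ • x with hP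
  have hPc : Continuous P := by
    refine Continuous.smul (Continuous.inv₀ (by fun_prop) fun x ↦ ?_) continuous_id
    positivity
  set s : E → ℝ := fun x ↦ max 0 (min 1 (‖x‖ - 1)) with hs
  set V : E → E := fun x ↦ (1 - s x) • u (P x) + s x • x with hV
  have hVc : Continuous V := by fun_prop
  have hVfar : ∀ x, 2 ≤ ‖x‖ → V x = x := by
    intro x hx
    have : s x = 1 := by simp only [hs]; rw [min_eq_left (by linarith)]; simp
    simp [hV, this]
  have hV0 : ∀ x, V x ≠ 0 := by
    intro x
    rcases le_or_gt ‖x‖ 1 with hx | hx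
    · have h1 : s x = 0 := by
        simp only [hs]; exact max_eq_left ((min_le_right _ _).trans (by linarith))
      have h2 : P x = x := by simp [hP, max_eq_left hx]
      simpa [hV, h1, h2] using hu0 x
    · have hxpos : 0 < ‖x‖ := one_pos.trans hx
      have h2 : P x = ‖x‖⁻¹ • x := by simp [hP, max_eq_right hx.le]
      have h0s : 0 ≤ s x := le_max_left _ _
      have hs1 : s x ≤ 1 := max_le zero_le_one (min_le_left _ _)
      intro h
      rcases hs1.eq_or_lt with h1 | h1
      · simp [hV, h1] at h
        simp [h] at hxpos
      · refine hcon (P x) ?_ ((1 - s x)⁻¹ * s x * ‖x‖) ?_ ?_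
        · rw [h2, norm_smul, norm_inv, norm_norm, inv_mul_cancel₀ hxpos.ne']
        · have : 0 ≤ (1 - s x)⁻¹ := inv_nonneg.2 (by linarith)
          positivity
        · have h3 : (1 - s x) • u (P x) = -(s x • x) := eq_neg_of_add_eq_zero_left h
          rw [← inv_smul_smul₀ (sub_pos.2 h1).ne' (u (P x)), h3, h2]
          simp only [smul_neg, smul_smul]
          rw [mul_assoc _ ‖x‖, mul_inv_cancel₀ hxpos.ne', mul_one]
  have hSU : {x : E | 2 < ‖x‖} ∈ 𝓝ˢ {x : E | 3 ≤ ‖x‖} :=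
    (isOpen_lt continuous_const continuous_norm).mem_nhdsSet.2 fun x (hx : 3 ≤ ‖x‖) ↦ by
      change 2 < ‖x‖; linarith
  -- Smoothing with pointwise error below `‖V x‖` creates no zeros, and it changes nothing for `‖x‖
  -- ≥ 3`, since `V` is already smooth beyond radius `2`. Normalizing `W` on the ball of radius `3`
  -- then gives a retraction.
  obtain ⟨W, hW, hWV, hWeq, -⟩ := hVc.exists_contDiff_approx_and_eqOn 1 hVc.norm
    (fun x ↦ norm_pos_iff.2 (hV0 x)) (isClosed_le continuous_const continuous_norm) hSU
    (contDiffOn_id.congr fun x hx ↦ hVfar x (le_of_lt hx))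
  have hW0 : ∀ x, W x ≠ 0 := by
    intro x h
    have := hWV x
    rw [h, dist_zero_left] at this
    exact lt_irrefl _ this
  have hW' : ContDiff ℝ 1 fun x : E ↦ W ((3 : ℝ) • x) := hW.comp (contDiff_const_smul _)
  refine not_exists_contDiff_retraction_sphere (fun x ↦ ‖W ((3 : ℝ) • x)‖⁻¹ • W ((3 : ℝ) • x))
    (((hW'.norm ℝ fun x ↦ hW0 _).inv fun x ↦ norm_ne_zero_iff.2 (hW0 _)).smul hW')
    (fun x ↦ ?_) fun x hx ↦ ?_
  · rw [norm_smul, norm_inv, norm_norm, inv_mul_cancel₀ (norm_ne_zero_iff.2 (hW0 _))]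
  · have h3 : ‖(3 : ℝ) • x‖ = 3 := by rw [norm_smul, hx]; norm_num
    have h4 : W ((3 : ℝ) • x) = (3 : ℝ) • x :=
      (hWeq (show 3 ≤ ‖(3 : ℝ) • x‖ from h3.ge)).trans (hVfar _ (by rw [h3]; norm_num))
    simp only [h4, h3]
    rw [inv_smul_smul₀ (by norm_num)]

end BrouwerTheory

/-! ### Lipschitz approximation and Hausdorff-null images -/

section EmbeddedBalls

open Metric Set MeasureTheory Filter Topology
open scoped NNReal ENNReal unitInterval

/-- On a compact set a continuous real function is a uniform limit of Lipschitz functions. -/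
theorem IsCompact.exists_lipschitzWith_approx_real {X : Type*} [MetricSpace X] {K : Set X}
    (hK : IsCompact K) {h : X → ℝ} (hh : Continuous h) {ε : ℝ} (hε : 0 < ε) :
    ∃ C, ∃ h' : X → ℝ, LipschitzWith C h' ∧ ∀ x ∈ K, dist (h' x) (h x) < ε := by
  have : CompactSpace K := isCompact_iff_compactSpace.1 hK
  set L : Set C(K, ℝ) := {φ | ∃ C, ∃ h' : X → ℝ, LipschitzWith C h' ∧ ∀ x : K, φ x = h' x}
  have hL : closure L = ⊤ := by
    refine ContinuousMap.sublattice_closure_eq_top L ⟨0, 0, fun _ ↦ 0, .const 0, fun _ ↦ rfl⟩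
      ?_ ?_ ?_
    · rintro φ ⟨C, a, ha, hφ⟩ ψ ⟨D, b, hb, hψ⟩
      exact ⟨_, _, ha.min hb, fun x ↦ by simp [hφ, hψ]⟩
    · rintro φ ⟨C, a, ha, hφ⟩ ψ ⟨D, b, hb, hψ⟩
      exact ⟨_, _, ha.max hb, fun x ↦ by simp [hφ, hψ]⟩
    -- The lattice form of Stone–Weierstrass asks for prescribed values at two points; an affine
    -- function of the distance to `x` attains them.
    · intro v x y
      set c : ℝ := (v y - v x) / dist x y
      have hlip : LipschitzWith ‖c‖₊ fun z : X ↦ v x + c * dist (x : X) z :=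
        LipschitzWith.of_dist_le_mul fun z z' ↦ by
          rw [dist_add_left, ← smul_eq_mul, ← smul_eq_mul, dist_smul₀]
          exact mul_le_mul_of_nonneg_left
            (by simpa using (LipschitzWith.dist_right (x : X)).dist_le_mul z z') (norm_nonneg c)
      refine ⟨⟨fun z ↦ v x + c * dist (x : X) z, by fun_prop⟩, ⟨_, _, hlip, fun _ ↦ rfl⟩, by simp,
        ?_⟩
      rcases eq_or_ne x y with rfl | hxy
      · simp
      · have : dist x y ≠ 0 := dist_ne_zero.2 hxy
        simp only [c, ContinuousMap.coe_mk, ← Subtype.dist_eq]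
        field_simp
        ring
  obtain ⟨φ, ⟨C, h', hC, hφ⟩, hdist⟩ := Metric.mem_closure_iff.1
    (show (⟨fun x : K ↦ h x, by fun_prop⟩ : C(K, ℝ)) ∈ closure L by rw [hL]; trivial) ε hε
  refine ⟨C, h', hC, fun x hx ↦ ?_⟩
  rw [dist_comm, ← hφ ⟨x, hx⟩]
  exact (ContinuousMap.dist_apply_le_dist ⟨x, hx⟩).trans_lt hdist

/-- On a compact set a continuous function to a finite-dimensional space is a uniform limit of
Lipschitz functions. -/
theorem IsCompact.exists_lipschitzWith_approx {X V : Type*} [MetricSpace X]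
    [NormedAddCommGroup V] [NormedSpace ℝ V] [FiniteDimensional ℝ V] {K : Set X}
    (hK : IsCompact K) {h : X → V} (hh : Continuous h) {ε : ℝ} (hε : 0 < ε) :
    ∃ C, ∃ h' : X → V, LipschitzWith C h' ∧ ∀ x ∈ K, dist (h' x) (h x) < ε := by
  set e : V ≃L[ℝ] Fin (Module.finrank ℝ V) → ℝ := ContinuousLinearEquiv.ofFinrankEq (by simp)
  set M : ℝ≥0 := ‖(e.symm : (Fin (Module.finrank ℝ V) → ℝ) →L[ℝ] V)‖₊ with hM
  have he : LipschitzWith M e.symm := e.symm.lipschitz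
  -- The summand `1` covers `M = 0`, which occurs when `V` is trivial.
  have hη : 0 < ε / (M + 1) := by positivity
  choose C a ha hclose using fun i ↦
    hK.exists_lipschitzWith_approx_real (h := fun x ↦ e (h x) i) (by fun_prop) hη
  refine ⟨M * ∑ i, C i, fun x ↦ e.symm fun i ↦ a i x, he.comp ?_, fun x hx ↦ ?_⟩
  · refine LipschitzWith.of_dist_le_mul fun x y ↦ (dist_pi_le_iff (by positivity)).2 fun i ↦ ?_
    refine ((ha i).dist_le_mul x y).trans ?_
    gcongr
    exact Finset.single_le_sum (f := C) (fun _ _ ↦ zero_le) (Finset.mem_univ i)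
  · have h1 := he.dist_le_mul (fun i ↦ a i x) (e (h x))
    rw [e.symm_apply_apply] at h1
    have h2 : dist (fun i ↦ a i x) (e (h x)) < ε / (M + 1) :=
      (dist_pi_lt_iff hη).2 fun i ↦ hclose i x hx
    refine h1.trans_lt ?_
    calc (M : ℝ) * dist (fun i ↦ a i x) (e (h x)) ≤ M * (ε / (M + 1)) := by gcongr
      _ < ε := by
        rw [mul_div_assoc', div_lt_iff₀ (by positivity)]
        nlinarith

/-- A Lipschitz map from a space of vanishing top-dimensional Hausdorff measure to a
finite-dimensional space misses arbitrarily small vectors. -/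
theorem LipschitzWith.exists_norm_lt_notMem_range {X V : Type*} [MetricSpace X]
    [MeasurableSpace X] [BorelSpace X] [NormedAddCommGroup V] [NormedSpace ℝ V]
    [FiniteDimensional ℝ V] (hX : Measure.hausdorffMeasure (Module.finrank ℝ V) (univ : Set X) = 0)
    {C : ℝ≥0} {h : X → V} (hh : LipschitzWith C h) {ε : ℝ} (hε : 0 < ε) :
    ∃ q : V, ‖q‖ < ε ∧ ∀ x, h x ≠ q := by
  let _ : MeasurableSpace V := borel V
  have _ : BorelSpace V := ⟨rfl⟩
  have hnull : Measure.hausdorffMeasure (Module.finrank ℝ V) (range h) = 0 := by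
    have := hh.hausdorffMeasure_image_le (Nat.cast_nonneg (Module.finrank ℝ V)) univ
    rw [hX, mul_zero, image_univ] at this
    exact le_antisymm this zero_le
  by_contra! hcon
  have hsub : ball (0 : V) ε ⊆ range h := fun q hq ↦ hcon q (by simpa using hq)
  -- In the dimension of `V`, Hausdorff measure is a Haar measure, hence positive on balls.
  exact (measure_ball_pos (Measure.hausdorffMeasure (Module.finrank ℝ V)) (0 : V) hε).ne'
    (measure_mono_null hsub hnull)

/-! ### Filling the glued sphere and covering the center -/

/-- In a contractible space, two balls with the same boundary parametrization bound: the sphere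
formed by them is filled by a ball of one dimension more. -/
theorem exists_continuous_filling {A X : Type*} [NormedAddCommGroup A] [InnerProductSpace ℝ A]
    [TopologicalSpace X] [ContractibleSpace X] {f g : A → X} (hf : Continuous f)
    (hg : Continuous g) (hfg : ∀ z, ‖z‖ = 1 → f z = g z) :
    ∃ F : WithLp 2 (A × ℝ) → X, Continuous F ∧
      ∀ w, ‖w‖ = 1 → F w = if 0 ≤ w.snd then f w.fst else g w.fst := by
  obtain ⟨y, ⟨H⟩⟩ := id_nullhomotopic X
  -- The contraction runs from time `0` on the unit sphere to time `1` on `‖w‖ ≤ 1/2`, where the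
  -- filling is constant. Where the halves meet outside that ball, `w.fst` rescaled by `ρ` has norm
  -- `1`, so `f` and `g` agree.
  set s : WithLp 2 (A × ℝ) → I := fun w ↦ projIcc 0 1 zero_le_one (2 - 2 * ‖w‖) with hs
  set ρ : WithLp 2 (A × ℝ) → ℝ := fun w ↦ max (1 / 2) ‖w‖ with hρ
  have hsc : Continuous s := continuous_projIcc.comp (by fun_prop)
  have hρ0 : ∀ w, ρ w ≠ 0 := fun w ↦ by positivity
  have hzc : Continuous fun w : WithLp 2 (A × ℝ) ↦ (ρ w)⁻¹ • w.fst :=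
    (Continuous.inv₀ (by fun_prop) hρ0).smul (by fun_prop)
  refine ⟨fun w ↦ if 0 ≤ w.snd then H (s w, f ((ρ w)⁻¹ • w.fst))
    else H (s w, g ((ρ w)⁻¹ • w.fst)), ?_, fun w hw ↦ ?_⟩
  · refine Continuous.if_le (by fun_prop) (by fun_prop) continuous_const (by fun_prop) ?_
    intro w hw
    rcases le_total ‖w‖ (1 / 2) with h | h
    · have : s w = 1 := by
        simp only [hs]
        exact projIcc_of_right_le _ (by linarith)
      simp [this]
    · rw [hfg]
      have hn : ‖w.fst‖ = ‖w‖ := by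
        have := WithLp.prod_norm_sq_eq_of_L2 w
        rw [← hw, norm_zero] at this
        exact ((sq_eq_sq₀ (norm_nonneg _) (norm_nonneg _)).1 (by simpa using this)).symm
      have hpos : ‖w‖ ≠ 0 := by positivity
      rw [norm_smul, hn, norm_inv]
      simp only [hρ, max_eq_right h, norm_norm]
      exact inv_mul_cancel₀ hpos
  · have h1 : s w = 0 := by
      simp only [hs, hw]
      exact projIcc_of_le_left _ (by norm_num)
    have h2 : ρ w = 1 := by simp only [hρ, hw]; norm_num
    simp [h1, h2]

/-- In a contractible metric space whose Hausdorff measure in dimension `dim A + 1` vanishes, a ball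
of dimension `dim A` with the same boundary as an embedded one covers the center of the latter. -/
theorem apply_zero_mem_image_closedBall {A X : Type*} [NormedAddCommGroup A]
    [InnerProductSpace ℝ A] [FiniteDimensional ℝ A] [MetricSpace X] [MeasurableSpace X]
    [BorelSpace X] [ContractibleSpace X]
    (hX : Measure.hausdorffMeasure ((Module.finrank ℝ A : ℝ) + 1) (univ : Set X) = 0)
    {f g : A → X} (hf : Continuous f) (hg : Continuous g) (hinj : InjOn f (closedBall 0 1))
    (hfg : ∀ z, ‖z‖ = 1 → f z = g z) : f 0 ∈ g '' closedBall 0 1 := by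
  by_contra hout
  set T : Set X := g '' closedBall 0 1 with hT
  have hTc : IsClosed T := ((isCompact_closedBall 0 1).image hg).isClosed
  have hTne : T.Nonempty := ⟨g 0, 0, by simp, rfl⟩
  set r : ℝ := infDist (f 0) T / 2 with hr
  have hr0 : 0 < r := half_pos ((hTc.notMem_iff_infDist_pos hTne).1 hout)
  obtain ⟨η, hη, hnear⟩ : ∃ η > 0, ∀ z : A, ‖z‖ < η → r / 2 ≤ infDist (f z) T - r := by
    have hc : Continuous fun z ↦ infDist (f z) T - r := by
      have := (continuous_infDist_pt T).comp hf
      exact this.sub continuous_const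
    have h0 : r / 2 < infDist (f 0) T - r := by rw [hr] at hr0 ⊢; linarith
    obtain ⟨η, hη, h⟩ := Metric.eventually_nhds_iff.1 (hc.continuousAt.eventually (lt_mem_nhds h0))
    exact ⟨η, hη, fun z hz ↦ (h (by simpa using hz)).le⟩
  -- a continuous left inverse of `f` on the ball
  obtain ⟨ζ, hζ⟩ : ∃ ζ : C(X, A), ∀ z ∈ closedBall (0 : A) 1, ζ (f z) = z := by
    have hce : IsClosedEmbedding fun z : closedBall (0 : A) 1 ↦ f z :=
      Continuous.isClosedEmbedding (by fun_prop) fun a b hab ↦ Subtype.ext (hinj a.2 b.2 hab)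
    have : TietzeExtension A := TietzeExtension.of_tvs ℝ
    obtain ⟨ζ, hζ⟩ := ContinuousMap.exists_extension' hce
      (⟨Subtype.val, continuous_subtype_val⟩ : C(closedBall (0 : A) 1, A))
    exact ⟨ζ, fun z hz ↦ congrFun hζ ⟨z, hz⟩⟩
  obtain ⟨F, hF, hFs⟩ := exists_continuous_filling hf hg hfg
  -- The last component is `-r` on `T` and `r` at `f 0`; by the choice of `η` it stays at least `r /
  -- 2` on the image under `f` of the `η`-ball.
  set h : X → WithLp 2 (A × ℝ) := fun x ↦ WithLp.toLp 2 (ζ x, infDist x T - r) with hh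
  have hhc : Continuous h := by
    have := continuous_infDist_pt T
    fun_prop
  set δ : ℝ := min η (r / 2) with hδ
  have hδ0 : 0 < δ := lt_min hη (half_pos hr0)
  obtain ⟨C, h', hC, happ⟩ := ((isCompact_closedBall (0 : WithLp 2 (A × ℝ)) 1).image
    hF).exists_lipschitzWith_approx hhc (half_pos hδ0)
  have hfin : (Module.finrank ℝ (WithLp 2 (A × ℝ)) : ℝ) = (Module.finrank ℝ A : ℝ) + 1 := by
    rw [(WithLp.linearEquiv 2 ℝ (A × ℝ)).finrank_eq]
    simp
  obtain ⟨q, hq, hqr⟩ := hC.exists_norm_lt_notMem_range (by rw [hfin]; exact hX) (half_pos hδ0)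
  obtain ⟨w, hw, c, hc, hwc⟩ := exists_mem_sphere_eq_neg_smul (fun w ↦ h' (F w) - q)
    ((hC.continuous.comp hF).sub continuous_const) fun w ↦ sub_ne_zero.2 (hqr _)
  have herr : ‖h (F w) + c • w‖ < δ := by
    have h1 : h (F w) + c • w = -(h' (F w) - h (F w)) + q := by
      rw [← neg_eq_iff_eq_neg] at hwc
      rw [← hwc]; abel
    have h2 := happ (F w) ⟨w, by simp [hw], rfl⟩
    rw [dist_eq_norm] at h2
    rw [h1]
    refine (norm_add_le _ _).trans_lt ?_
    rw [norm_neg]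
    linarith
  have hfst : ‖ζ (F w) + c • w.fst‖ < δ := (WithLp.norm_fst_le _ (h (F w) + c • w)).trans_lt herr
  have hsnd : |infDist (F w) T - r + c * w.snd| < δ :=
    (WithLp.norm_snd_le _ (h (F w) + c • w)).trans_lt herr
  have hz1 : ‖w.fst‖ ≤ 1 := (WithLp.norm_fst_le _ w).trans hw.le
  have hδr : δ ≤ r / 2 := min_le_right _ _
  rw [hFs w hw] at hfst hsnd
  split_ifs at hfst hsnd with ht
  -- Upper hemisphere: `(1 + c) ‖w.fst‖ < δ ≤ η` puts `w.fst` near the center, where the last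
  -- component is at least `r / 2 ≥ δ`, and `c * w.snd ≥ 0` only adds to it.
  · rw [hζ _ (by simpa using hz1)] at hfst
    have hsmall : ‖w.fst‖ < η := by
      have h1 : w.fst + c • w.fst = (1 + c) • w.fst := by module
      rw [h1, norm_smul, Real.norm_of_nonneg (by linarith)] at hfst
      have : δ ≤ η := min_le_left _ _
      nlinarith [norm_nonneg w.fst]
    have h2 := hnear _ hsmall
    have h3 := (abs_lt.1 hsnd).2
    have h4 := mul_nonneg hc ht
    linarith
  -- Lower hemisphere: the last component is `-r`, and `c * w.snd ≤ 0` cannot bring it within `δ ≤ r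
  -- / 2` of zero.
  · have hmem : g w.fst ∈ T := ⟨w.fst, by simpa using hz1, rfl⟩
    rw [infDist_zero_of_mem hmem] at hsnd
    have h3 := (abs_lt.1 hsnd).1
    have h4 := mul_nonpos_of_nonneg_of_nonpos hc (not_le.1 ht).le
    linarith

/-! ### Reparametrizing embedded balls -/

/-- Pushing the center of the closed unit ball to an interior point `a`, along the cone structure.
-/
theorem injective_add_one_sub_norm_smul {A : Type*} [NormedAddCommGroup A] [NormedSpace ℝ A]
    {a : A} (ha : ‖a‖ < 1) : Function.Injective fun z : A ↦ z + (1 - ‖z‖) • a := by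
  intro z z' h
  have h1 : z - z' = (‖z‖ - ‖z'‖) • a := by
    rw [← sub_eq_zero] at h ⊢
    rw [← h]; module
  have h2 : ‖z - z'‖ ≤ ‖z - z'‖ * ‖a‖ := by
    conv_lhs => rw [h1, norm_smul]
    gcongr
    exact abs_norm_sub_norm_le z z'
  by_contra hne
  have h3 : 0 < ‖z - z'‖ := norm_pos_iff.2 (sub_ne_zero.2 hne)
  nlinarith

/-- The closed unit ball of a finite-dimensional space is a retract of that space. -/
theorem exists_retraction_closedBall (A : Type*) [NormedAddCommGroup A] [NormedSpace ℝ A]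
    [FiniteDimensional ℝ A] :
    ∃ p : A → closedBall (0 : A) 1, Continuous p ∧ ∀ z : closedBall (0 : A) 1, p z = z := by
  have : TietzeExtension (closedBall (0 : A) 1) :=
    Metric.instTietzeExtensionClosedBall ℝ 0 one_pos
  obtain ⟨p, hp⟩ := ContinuousMap.exists_extension'
    (isClosed_closedBall (x := (0 : A)) (ε := 1)).isClosedEmbedding_subtypeVal
    (ContinuousMap.id (closedBall (0 : A) 1))
  exact ⟨p, p.continuous, congrFun hp⟩

/-- If an embedding of the closed unit ball covers the image of the unit sphere under another map,
then the embedded ball can be reparametrized so as to agree with that map on the unit sphere. -/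
theorem exists_reparametrization_eq_on_sphere {A X : Type*} [NormedAddCommGroup A]
    [NormedSpace ℝ A] [FiniteDimensional ℝ A] [TopologicalSpace X] {f g : closedBall (0 : A) 1 → X}
    (hf : Continuous f) (hg : IsEmbedding g)
    (hfg : ∀ z : closedBall (0 : A) 1, ‖(z : A)‖ = 1 → f z ∈ range g) :
    ∃ θ : closedBall (0 : A) 1 → closedBall (0 : A) 1, Continuous θ ∧
      ∀ z : closedBall (0 : A) 1, ‖(z : A)‖ = 1 → g (θ z) = f z := by
  have : TietzeExtension (closedBall (0 : A) 1) :=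
    Metric.instTietzeExtensionClosedBall ℝ 0 one_pos
  set Sph : Set (closedBall (0 : A) 1) := {z | ‖(z : A)‖ = 1}
  have hSph : IsClosed Sph := isClosed_eq (by fun_prop) continuous_const
  -- On the sphere `θ` is forced to be `g⁻¹ ∘ f`; Tietze extends it inward, at the price of
  -- injectivity.
  set θ₀ : C(Sph, closedBall (0 : A) 1) :=
    ⟨fun z ↦ hg.toHomeomorph.symm ⟨f z, hfg z z.2⟩, hg.toHomeomorph.symm.continuous.comp
      (Continuous.subtype_mk (hf.comp continuous_subtype_val) _)⟩ with hθ₀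
  obtain ⟨θ, hθ⟩ := θ₀.exists_restrict_eq hSph
  refine ⟨θ, θ.continuous, fun z hz ↦ ?_⟩
  have h1 : θ z = hg.toHomeomorph.symm ⟨f z, hfg z hz⟩ := congr($hθ ⟨z, hz⟩)
  rw [h1]
  exact congrArg Subtype.val (hg.toHomeomorph.apply_symm_apply ⟨f z, hfg z hz⟩)

/-- In a contractible metric space with vanishing `(n + 1)`-dimensional Hausdorff measure, an
embedded closed `n`-ball is contained in any other one with the same boundary. -/
theorem IsEmbeddedClosedBall.subset {X : Type*} [MetricSpace X] [MeasurableSpace X] [BorelSpace X]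
    [ContractibleSpace X] {n : ℕ}
    (hX : Measure.hausdorffMeasure ((n : ℝ) + 1) (univ : Set X) = 0) {D₁ D₂ S : Set X}
    (hD₁ : IsEmbeddedClosedBall n D₁ S) (hD₂ : IsEmbeddedClosedBall n D₂ S) : D₁ ⊆ D₂ := by
  obtain ⟨f, hf, rfl, rfl⟩ := hD₁
  obtain ⟨g, hg, rfl, hS⟩ := hD₂
  have hbd : ∀ z : closedBall (0 : EuclideanSpace ℝ (Fin n)) 1, ‖(z : EuclideanSpace ℝ (Fin n))‖ = 1 →
      f z ∈ range g := by
    intro z hz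
    have : f z ∈ g '' _ := hS.symm ▸ mem_image_of_mem f (by simpa using hz)
    exact image_subset_range _ _ this
  rintro _ ⟨a, rfl⟩
  have ha : ‖(a : EuclideanSpace ℝ (Fin n))‖ ≤ 1 := mem_closedBall_zero_iff.1 a.2
  rcases ha.eq_or_lt with ha | ha
  · exact hbd a ha
  obtain ⟨p, hp, hpid⟩ := exists_retraction_closedBall (EuclideanSpace ℝ (Fin n))
  obtain ⟨θ, hθ, hgθ⟩ := exists_reparametrization_eq_on_sphere hf.continuous hg hbd
  have hball : ∀ z ∈ closedBall (0 : EuclideanSpace ℝ (Fin n)) 1,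
      z + (1 - ‖z‖) • (a : EuclideanSpace ℝ (Fin n)) ∈ closedBall 0 1 := by
    intro z hz
    simp only [mem_closedBall, dist_zero_right] at hz ⊢
    refine (norm_add_le _ _).trans ?_
    rw [norm_smul, Real.norm_of_nonneg (by linarith)]
    nlinarith
  have hpv : ∀ z ∈ closedBall (0 : EuclideanSpace ℝ (Fin n)) 1, (p z : _) = z := fun z hz ↦
    congrArg Subtype.val (hpid ⟨z, hz⟩)
  -- The first map moves the center to `a` and fixes the sphere. The second need not be injective,
  -- which is harmless: only its values in `range g` matter. The retraction `p` extends both to the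
  -- whole space.
  have key := apply_zero_mem_image_closedBall (A := EuclideanSpace ℝ (Fin n)) (X := X)
    (f := fun z ↦ f (p (z + (1 - ‖z‖) • (a : EuclideanSpace ℝ (Fin n)))))
    (g := fun z ↦ g (θ (p z))) (by simpa using hX)
    (hf.continuous.comp (hp.comp (by fun_prop))) (hg.continuous.comp (hθ.comp hp)) ?_ ?_
  · obtain ⟨z, -, hz⟩ := key
    have h0 : p (0 + (1 - ‖(0 : EuclideanSpace ℝ (Fin n))‖) •
        (a : EuclideanSpace ℝ (Fin n))) = a := by
      simpa using hpid a
    simp only [h0] at hz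
    exact ⟨_, hz⟩
  · intro z hz z' hz' h
    have h1 := congrArg Subtype.val (hf.injective h)
    rw [hpv _ (hball z hz), hpv _ (hball z' hz')] at h1
    exact injective_add_one_sub_norm_smul ha h1
  · intro z hz
    have hpz : p z = ⟨z, by simp [hz]⟩ := hpid ⟨z, by simp [hz]⟩
    have := hgθ (p z) (by rw [hpz]; exact hz)
    simp [hz, this]

end EmbeddedBalls

theorem corollary2p9 {X : Type*} [MetricSpace X] [MeasurableSpace X] [BorelSpace X]
    [ContractibleSpace X] (n : ℕ)
    (hX : MeasureTheory.Measure.hausdorffMeasure ((n : ℝ) + 1) (Set.univ : Set X) = 0)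
    (D₁ D₂ S : Set X)
    (hD₁ : IsEmbeddedClosedBall n D₁ S) (hD₂ : IsEmbeddedClosedBall n D₂ S) :
    D₁ = D₂ :=
  (hD₁.subset hX hD₂).antisymm (hD₂.subset hX hD₁)
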